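/- Let $d\ge 1$, and let $\mathcal D$ be the collection of standard half-open dyadic cubes $2^{n}([0,1)^d+m)$, $n\in\mathbb Z$, $m\in\mathbb Z^d$, in $\mathbb R^d$. The dyadic parent $\hat Q$ of $Q\in\mathcal D$ is the dyadic cube of twice the side length that contains $Q$, and the dyadic ancestors are defined by $Q^{(0)}=Q$, $Q^{(k+1)}=\widehat{Q^{(k)}}$. Let $\mu$ be a locally finite Borel measure on $\mathbb R^d$. For $\mathcal F\subseteq\mathcal D$ and $F\in\mathcal F$ let $\mathrm{ch}_{\mathcal F}(F)$ be the set of the maximal (with respect to inclusion) cubes $F'\in\mathcal F$ with $F'\subsetneq F$. For $\gamma\in(0,1)$, the collection $\mathcal F$ is called $\gamma$-sparse (with respect to $\mu$) if $\sum_{F'\in \mathrm{ch}_{\mathcal F}(F)}\mu(F')\le\gamma\,\mu(F)$ for every $F\in\mathcal F$; it is sparse if it is $\gamma$-sparse for some $\gamma\in(0,1)$. For a measurable function $f:\mathbb R^d\to\mathbb R$ write $\langle |f|\rangle_Q=\frac1{\mu(Q)}\int_Q|f|\,d\mu\in[0,\infty]$ (with $\langle |f|\rangle_Q=0$ if $\mu(Q)=0$).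 **Theorem (Conde-Alonso–Rey pointwise domination).** For every $\gamma\in(0,1)$ there is a constant $C<\infty$, depending only on $\gamma$, such that the following holds for every $d\ge1$, every locally finite Borel measure $\mu$ on $\mathbb R^d$ and every integer $k\ge 0$. Let $\mathcal S\subseteq\mathcal D$ be a $\gamma$-sparse collection that contains a maximal cube, that is, a cube $S_0\in\mathcal S$ with $S\subseteq S_0$ for all $S\in\mathcal S$, and let $f:\mathbb R^d\to\mathbb R$ be ($\mu$-)measurable. Then there exists a $\tfrac12$-sparse (in particular, sparse) collection $\mathcal T\subseteq\mathcal D$, depending on $\mu$, $\mathcal S$, $k$ and $f$, such that $$\sum_{S\in\mathcal S}\langle |f|\rangle_{S^{(k)}}1_S\;\le\; C\,(k+1)\sum_{T\in\mathcal T}\langle |f|\rangle_{T}1_T\qquad \mu\text{-almost everywhere.}$$ -/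

import Mathlib

open MeasureTheory
open scoped NNReal ENNReal

/-- A dyadic cube of the standard dyadic system of `ℝ^d`, given by its generation and position:
the half-open cube of side length `2 ^ scale` with lower corner `2 ^ scale • index`.
For `d ≥ 1` different data give different sets. -/
@[ext]
structure DyadicCube (d : ℕ) where
  scale : ℤ
  index : Fin d → ℤ

namespace DyadicCube

/-- The points of the cube. -/
def toSet {d : ℕ} (Q : DyadicCube d) : Set (Fin d → ℝ) :=
  {x | ∀ i, x i ∈ Set.Ico ((Q.index i : ℝ) * 2 ^ Q.scale) (((Q.index i : ℝ) + 1) * 2 ^ Q.scale)}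

/-- The dyadic parent: the cube of twice the side length that contains the given cube
(integer division by `2` rounds down). -/
def parent {d : ℕ} (Q : DyadicCube d) : DyadicCube d where
  scale := Q.scale + 1
  index := fun i => Q.index i / 2

/-- The `k`-th dyadic ancestor. -/
def ancestor {d : ℕ} (k : ℕ) (Q : DyadicCube d) : DyadicCube d :=
  parent^[k] Q

/-- The children of the cube `F` in the collection `𝓕`: the maximal elements, with respect to
inclusion, among the cubes of `𝓕` that are strictly contained in `F`. -/
def childrenIn {d : ℕ} (𝓕 : Set (DyadicCube d)) (F : DyadicCube d) : Set (DyadicCube d) :=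
  {F' | F' ∈ 𝓕 ∧ F'.toSet ⊂ F.toSet ∧
    ∀ G ∈ 𝓕, G.toSet ⊂ F.toSet → F'.toSet ⊆ G.toSet → G = F'}

end DyadicCube

/-- The collection `𝓕` is sparse with constant `γ` with respect to `μ`: the total measure of the
`𝓕`-children of each cube `F` of `𝓕` is at most `γ * μ F`. -/
def IsSparseWith {d : ℕ} (μ : Measure (Fin d → ℝ)) (γ : ℝ≥0) (𝓕 : Set (DyadicCube d)) : Prop :=
  ∀ F ∈ 𝓕, ∑' F' : DyadicCube.childrenIn 𝓕 F, μ F'.1.toSet ≤ γ * μ F.toSet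

/-- The average of `|f|` over the cube `Q`, in `[0, ∞]`
(with value `0` if the cube has measure `0`). -/
noncomputable def cubeAverage {d : ℕ} (μ : Measure (Fin d → ℝ)) (f : (Fin d → ℝ) → ℝ)
    (Q : DyadicCube d) : ℝ≥0∞ :=
  ⨍⁻ x in Q.toSet, ‖f x‖ₑ ∂μ

/-- The positive dyadic operator of complexity `k` of the collection `𝓢`, applied to `|f|`:
the function `∑_{S ∈ 𝓢} ⟨|f|⟩_{S^(k)} 1_S` with values in `[0, ∞]`. -/
noncomputable def positiveDyadicOperator {d : ℕ} (μ : Measure (Fin d → ℝ))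
    (𝓢 : Set (DyadicCube d)) (k : ℕ) (f : (Fin d → ℝ) → ℝ) (x : Fin d → ℝ) : ℝ≥0∞ :=
  ∑' S : 𝓢, S.1.toSet.indicator (fun _ => cubeAverage μ f (S.1.ancestor k)) x

/-! ### Nestedness of dyadic cubes and maximal subcubes. -/

namespace DyadicCube

variable {d : ℕ} {Q R : DyadicCube d} {x : Fin d → ℝ}

/-! The proof is a stopping-time argument below `Q₀ = S₀^(k)`. Inside a cube Q one stops at the
maximal P ⊊ Q with ⟨|f|⟩_P > 4⟨|f|⟩_Q, or with more than M cubes S ⊇ P of 𝓢 satisfying S^(k) ⊆ Q.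
Disjointness bounds the total measure of the first kind by μ(Q)/4. Chebyshev and Carleson packing
bound the second by μ(Q)/(M(1-γ)) ≤ μ(Q)/4. So the stopping tree is 1/2-sparse
(`tsum_stoppingCubes_le`).

For x in a stopping cube P, at most M + k cubes S ∋ x have S^(k) ⊆ Q but S^(k) ⊄ P: at most M
contain the parent of P, which violates the count condition, and at most k lie inside P
(`encard_localCubes_diff_le`). For each, S^(k) lies in no stopping cube, so ⟨|f|⟩_{S^(k)} ≤
4⟨|f|⟩_Q. This one-step estimate iterates down the tree (`le_tsum_generation`), which almost every
point leaves after finitely many steps (`ae_exists_notMem_generation`). -/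

instance : Countable (DyadicCube d) :=
  Function.Injective.countable (f := fun Q : DyadicCube d => (Q.scale, Q.index))
    fun _ _ h => DyadicCube.ext (congrArg Prod.fst h) (congrArg Prod.snd h)

/-- The dyadic cube of scale `n` that contains `x`. -/
noncomputable def containing (n : ℤ) (x : Fin d → ℝ) : DyadicCube d where
  scale := n
  index := fun i => ⌊x i / 2 ^ n⌋

lemma mem_toSet_iff : x ∈ Q.toSet ↔ Q = containing Q.scale x := by
  have h2 : (0 : ℝ) < 2 ^ Q.scale := by positivity
  have : Q = containing Q.scale x ↔ ∀ i, ⌊x i / 2 ^ Q.scale⌋ = Q.index i := by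
    constructor
    · intro h i
      exact (congrFun (congrArg DyadicCube.index h) i).symm
    · intro h
      exact DyadicCube.ext rfl (funext fun i => (h i).symm)
  rw [this]
  refine forall_congr' fun i => ?_
  rw [Int.floor_eq_iff, le_div_iff₀ h2, div_lt_iff₀ h2, Set.mem_Ico]

lemma parent_containing (n : ℤ) (x : Fin d → ℝ) :
    parent (containing n x) = containing (n + 1) x := by
  refine DyadicCube.ext rfl (funext fun i => ?_)
  have : x i / 2 ^ (n + 1) = x i / 2 ^ n / (2 : ℕ) := by
    rw [zpow_add_one₀ two_ne_zero, div_div, Nat.cast_two]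
  simp only [parent, containing, this, Int.floor_div_natCast]
  rfl

lemma mem_parent (h : x ∈ Q.toSet) : x ∈ Q.parent.toSet := by
  rw [mem_toSet_iff] at h ⊢
  rw [h, parent_containing]
  rfl

lemma ancestor_succ (k : ℕ) (Q : DyadicCube d) : Q.ancestor (k + 1) = (Q.ancestor k).parent :=
  Function.iterate_succ_apply' _ _ _

lemma mem_ancestor (h : x ∈ Q.toSet) (k : ℕ) : x ∈ (Q.ancestor k).toSet := by
  induction k with
  | zero => exact h
  | succ k ih => rw [ancestor_succ]; exact mem_parent ih

lemma subset_ancestor (k : ℕ) (Q : DyadicCube d) : Q.toSet ⊆ (Q.ancestor k).toSet :=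
  fun _ h => mem_ancestor h k

lemma scale_ancestor (k : ℕ) (Q : DyadicCube d) : (Q.ancestor k).scale = Q.scale + k := by
  induction k with
  | zero => simp [ancestor]
  | succ k ih => rw [ancestor_succ, parent, ih]; push_cast; ring

lemma eq_of_mem (hQ : x ∈ Q.toSet) (hR : x ∈ R.toSet) (h : Q.scale = R.scale) : Q = R := by
  rw [mem_toSet_iff] at hQ hR
  rw [hQ, hR, h]

lemma subset_of_mem (hQ : x ∈ Q.toSet) (hR : x ∈ R.toSet) (h : Q.scale ≤ R.scale) :
    Q.toSet ⊆ R.toSet := by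
  obtain ⟨n, hn⟩ := Int.le.dest h
  rw [← eq_of_mem (mem_ancestor hQ n) hR (by rw [scale_ancestor, hn])]
  exact subset_ancestor n Q

lemma nonempty_toSet (Q : DyadicCube d) : Q.toSet.Nonempty := by
  have h2 : (0 : ℝ) < 2 ^ Q.scale := by positivity
  exact ⟨fun i => Q.index i * 2 ^ Q.scale, fun i => ⟨le_rfl, by nlinarith⟩⟩

lemma measurableSet_toSet (Q : DyadicCube d) : MeasurableSet Q.toSet := by
  have : Q.toSet = Set.univ.pi fun i => Set.Ico ((Q.index i : ℝ) * 2 ^ Q.scale)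
      (((Q.index i : ℝ) + 1) * 2 ^ Q.scale) := by
    ext x
    simp [toSet]
  rw [this]
  exact MeasurableSet.univ_pi fun _ => measurableSet_Ico

lemma measure_toSet_lt_top (μ : Measure (Fin d → ℝ)) [IsLocallyFiniteMeasure μ]
    (Q : DyadicCube d) : μ Q.toSet < ∞ := by
  refine (measure_mono (t := Set.Icc (fun i => (Q.index i : ℝ) * 2 ^ Q.scale)
    fun i => ((Q.index i : ℝ) + 1) * 2 ^ Q.scale) ?_).trans_lt isCompact_Icc.measure_lt_top
  exact fun x hx => ⟨fun i => (hx i).1, fun i => (hx i).2.le⟩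

/-- False for d = 0, where every cube is the whole one-point space. Otherwise a larger Q contains
two points whose first coordinates differ by the side of R, too far apart for the half-open R. -/
lemma scale_le_of_subset [NeZero d] (h : Q.toSet ⊆ R.toSet) : Q.scale ≤ R.scale := by
  by_contra! hlt
  have hR : (0 : ℝ) < 2 ^ R.scale := by positivity
  have hQR : (2 : ℝ) ^ R.scale < 2 ^ Q.scale := zpow_lt_zpow_right₀ one_lt_two hlt
  have h1 := h (a := fun i => Q.index i * 2 ^ Q.scale) (fun i => ⟨le_rfl, by nlinarith⟩) 0
  have h2 := h (a := fun i => Q.index i * 2 ^ Q.scale + 2 ^ R.scale)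
    (fun i => ⟨by simp only; linarith, by simp only; linarith⟩) 0
  have := h1.1
  have := h2.2
  simp only at *
  linarith

lemma toSet_injective [NeZero d] : Function.Injective (toSet (d := d)) := fun Q R h => by
  obtain ⟨x, hx⟩ := Q.nonempty_toSet
  exact eq_of_mem hx (h ▸ hx) ((scale_le_of_subset h.le).antisymm (scale_le_of_subset h.ge))

lemma scale_lt_of_ssubset [NeZero d] (h : Q.toSet ⊂ R.toSet) : Q.scale < R.scale := by
  refine lt_of_le_of_ne (scale_le_of_subset h.subset) fun he => ?_
  obtain ⟨x, hx⟩ := Q.nonempty_toSet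
  exact h.ne (congrArg toSet (eq_of_mem hx (h.subset hx) he))

lemma ssubset_of_mem [NeZero d] (hQ : x ∈ Q.toSet) (hR : x ∈ R.toSet) (h : Q.scale < R.scale) :
    Q.toSet ⊂ R.toSet :=
  ⟨subset_of_mem hQ hR h.le, fun h' => h.not_ge (scale_le_of_subset h')⟩

lemma eq_of_mem_childrenIn {𝓕 : Set (DyadicCube d)} {F P R : DyadicCube d} (hP : P ∈ childrenIn 𝓕 F)
    (hR : R ∈ childrenIn 𝓕 F) (hxP : x ∈ P.toSet) (hxR : x ∈ R.toSet) : P = R := by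
  rcases le_total P.scale R.scale with h | h
  · exact (hP.2.2 R hR.1 hR.2.1 (subset_of_mem hxP hxR h)).symm
  · exact hR.2.2 P hP.1 hP.2.1 (subset_of_mem hxR hxP h)

section Children

variable [NeZero d] {𝓕 : Set (DyadicCube d)} {F G : DyadicCube d}

/-- Scales of subcubes of F are bounded by that of F, so a candidate of greatest scale exists. -/
lemma exists_childrenIn (hG : G ∈ 𝓕) (hGF : G.toSet ⊂ F.toSet) :
    ∃ P ∈ childrenIn 𝓕 F, G.toSet ⊆ P.toSet := by
  obtain ⟨n, ⟨P, ⟨hP, hPF, hGP⟩, rfl⟩, hmax⟩ :=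
    Int.exists_greatest_of_bdd
      (P := fun n => ∃ P : DyadicCube d, (P ∈ 𝓕 ∧ P.toSet ⊂ F.toSet ∧ G.toSet ⊆ P.toSet) ∧
        P.scale = n)
      ⟨F.scale, by rintro n ⟨P, ⟨_, h, _⟩, rfl⟩; exact scale_le_of_subset h.subset⟩
      ⟨_, G, ⟨hG, hGF, subset_rfl⟩, rfl⟩
  refine ⟨P, ⟨hP, hPF, fun R hR hRF hPR => ?_⟩, hGP⟩
  obtain ⟨x, hx⟩ := P.nonempty_toSet
  exact eq_of_mem (hPR hx) hx ((hmax _ ⟨R, ⟨hR, hRF, hGP.trans hPR⟩, rfl⟩).antisymm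
    (scale_le_of_subset hPR))

end Children

end DyadicCube

/-! ### Packing of disjoint and of sparse families. -/

namespace DyadicCube

variable {d : ℕ}

lemma tsum_measure_le (ν : Measure (Fin d → ℝ)) {𝓐 : Set (DyadicCube d)}
    (h𝓐 : ∀ P ∈ 𝓐, ∀ R ∈ 𝓐, ∀ x ∈ P.toSet, x ∈ R.toSet → P = R) {s : Set (Fin d → ℝ)}
    (hs : ∀ P ∈ 𝓐, P.toSet ⊆ s) : ∑' P : 𝓐, ν P.1.toSet ≤ ν s := by
  refine (tsum_meas_le_meas_iUnion_of_disjoint ν (fun P : 𝓐 => P.1.measurableSet_toSet)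
    fun P R hPR => ?_).trans (measure_mono (Set.iUnion_subset fun P => hs P.1 P.2))
  exact Set.disjoint_left.2 fun x hP hR => hPR (Subtype.ext (h𝓐 P P.2 R R.2 x hP hR))

/-- Carleson packing of a sparse collection. -/
lemma tsum_measure_le_of_isSparseWith [NeZero d] {μ : Measure (Fin d → ℝ)}
    [IsLocallyFiniteMeasure μ] {γ : ℝ≥0} {𝓢 𝓛 : Set (DyadicCube d)} (h𝓢 : IsSparseWith μ γ 𝓢)
    (h𝓛 : 𝓛 ⊆ 𝓢) {s : Set (Fin d → ℝ)} (hs : ∀ S ∈ 𝓛, S.toSet ⊆ s) :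
    ((1 - γ : ℝ≥0) : ℝ≥0∞) * ∑' S : 𝓛, μ S.1.toSet ≤ μ s := by
  -- Removing the children leaves pairwise disjoint sets that keep a proportion 1 - γ of each cube.
  set E : DyadicCube d → Set (Fin d → ℝ) :=
    fun S => S.toSet \ ⋃ P : childrenIn 𝓢 S, P.1.toSet with hE
  have hEle (S : DyadicCube d) (hS : S ∈ 𝓢) :
      ((1 - γ : ℝ≥0) : ℝ≥0∞) * μ S.toSet ≤ μ (E S) := by
    have h1 : μ S.toSet ≤ μ (E S) + γ * μ S.toSet := by
      calc μ S.toSet ≤ μ (E S ∪ ⋃ P : childrenIn 𝓢 S, P.1.toSet) := by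
            rw [hE, Set.sdiff_union_self]
            exact measure_mono Set.subset_union_left
        _ ≤ μ (E S) + μ (⋃ P : childrenIn 𝓢 S, P.1.toSet) := measure_union_le _ _
        _ ≤ μ (E S) + γ * μ S.toSet := by
            gcongr
            exact (measure_iUnion_le _).trans (h𝓢 S hS)
    rw [ENNReal.coe_sub, ENNReal.coe_one, ENNReal.sub_mul
      (fun _ _ => (S.measure_toSet_lt_top μ).ne), one_mul]
    exact tsub_le_iff_right.2 h1
  rw [← ENNReal.tsum_mul_left]
  refine (ENNReal.tsum_le_tsum fun S : 𝓛 => hEle S (h𝓛 S.2)).trans ?_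
  refine (tsum_meas_le_meas_iUnion_of_disjoint μ
    (fun S : 𝓛 => S.1.measurableSet_toSet.diff
      (MeasurableSet.iUnion fun P => P.1.measurableSet_toSet)) fun S R hSR => ?_).trans
    (measure_mono (Set.iUnion_subset fun S => Set.sdiff_subset.trans (hs S.1 S.2)))
  refine Set.disjoint_left.2 fun x hS hR => ?_
  have key (S R : DyadicCube d) (hR : R ∈ 𝓢) (hxS : x ∈ E S) (hxR : x ∈ R.toSet) :
      S.scale ≤ R.scale := by
    by_contra! hlt
    obtain ⟨P, hP, hRP⟩ := exists_childrenIn hR (ssubset_of_mem hxR hxS.1 hlt)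
    exact hxS.2 (Set.mem_iUnion.2 ⟨⟨P, hP⟩, hRP hxR⟩)
  exact hSR (Subtype.ext (eq_of_mem hS.1 hR.1
    ((key S R (h𝓛 R.2) hS hR.1).antisymm (key R S (h𝓛 S.2) hR hS.1))))

/-! ### Trees generated by a stopping rule. -/

section Iteration

variable (next : DyadicCube d → Set (DyadicCube d)) (Q₀ : DyadicCube d)

/-- The cubes that are reached from `Q₀` by applying `next` exactly `n` times. -/
def generation : ℕ → Set (DyadicCube d)
  | 0 => {Q₀}
  | n + 1 => ⋃ Q ∈ generation n, next Q

variable {next Q₀} {μ : Measure (Fin d → ℝ)}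

lemma subset_of_mem_generation (hsub : ∀ Q, ∀ P ∈ next Q, P.toSet ⊂ Q.toSet) {n : ℕ}
    {Q : DyadicCube d} (hQ : Q ∈ generation next Q₀ n) : Q.toSet ⊆ Q₀.toSet := by
  induction n generalizing Q with
  | zero => rw [show Q = Q₀ from hQ]
  | succ n ih =>
    obtain ⟨R, hR, hQR⟩ := Set.mem_iUnion₂.1 hQ
    exact (hsub R Q hQR).subset.trans (ih hR)

lemma exists_mem_next_of_ssubset [NeZero d] (hsub : ∀ Q, ∀ P ∈ next Q, P.toSet ⊂ Q.toSet)
    (hdis : ∀ Q, ∀ P ∈ next Q, ∀ R ∈ next Q, ∀ x ∈ P.toSet, x ∈ R.toSet → P = R) {m n : ℕ}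
    {F G : DyadicCube d} (hF : F ∈ generation next Q₀ m) (hG : G ∈ generation next Q₀ n)
    (hGF : G.toSet ⊂ F.toSet) : ∃ P ∈ next F, G.toSet ⊆ P.toSet := by
  induction hN : m + n using Nat.strong_induction_on generalizing m n F G with
  | _ N ih =>
  subst hN
  cases n with
  | zero =>
    rw [show G = Q₀ from hG] at hGF
    exact absurd (subset_of_mem_generation hsub hF) hGF.2
  | succ n =>
    obtain ⟨R, hR, hGR⟩ := Set.mem_iUnion₂.1 hG
    have hsubR := hsub R G hGR
    obtain ⟨x, hx⟩ := G.nonempty_toSet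
    have hxR := hsubR.subset hx
    have hxF := hGF.subset hx
    rcases lt_trichotomy R.scale F.scale with h | h | h
    · obtain ⟨P, hP, hRP⟩ := ih (m + n) (by omega) hF hR (ssubset_of_mem hxR hxF h) rfl
      exact ⟨P, hP, hsubR.subset.trans hRP⟩
    · obtain rfl := eq_of_mem hxR hxF h
      exact ⟨G, hGR, subset_rfl⟩
    · obtain ⟨P, hP, hFP⟩ := ih (n + m) (by omega) hR hF (ssubset_of_mem hxF hxR h) rfl
      obtain rfl := hdis R G hGR P hP x hx (hFP hxF)
      exact absurd hFP hGF.2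

/-- A child of F in the tree lies in some cube of `next F`, hence equals it by maximality. -/
lemma isSparseWith_iUnion_generation [NeZero d]
    (hsub : ∀ Q, ∀ P ∈ next Q, P.toSet ⊂ Q.toSet)
    (hdis : ∀ Q, ∀ P ∈ next Q, ∀ R ∈ next Q, ∀ x ∈ P.toSet, x ∈ R.toSet → P = R) {δ : ℝ≥0}
    (hμ : ∀ Q, ∑' P : next Q, μ P.1.toSet ≤ δ * μ Q.toSet) :
    IsSparseWith μ δ (⋃ n, generation next Q₀ n) := by
  intro F hF
  refine (ENNReal.tsum_mono_subtype (fun P : DyadicCube d => μ P.toSet) fun G hG => ?_).trans (hμ F)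
  obtain ⟨m, hm⟩ := Set.mem_iUnion.1 hF
  obtain ⟨n, hn⟩ := Set.mem_iUnion.1 hG.1
  obtain ⟨P, hP, hGP⟩ := exists_mem_next_of_ssubset hsub hdis hm hn hG.2.1
  have hPT : P ∈ ⋃ n, generation next Q₀ n :=
    Set.mem_iUnion.2 ⟨m + 1, Set.mem_iUnion₂.2 ⟨F, hm, hP⟩⟩
  rwa [← hG.2.2 P hPT (hsub F P hP) hGP]

lemma tsum_generation_le {δ : ℝ≥0} (hμ : ∀ Q, ∑' P : next Q, μ P.1.toSet ≤ δ * μ Q.toSet)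
    (n : ℕ) : ∑' Q : generation next Q₀ n, μ Q.1.toSet ≤ (δ : ℝ≥0∞) ^ n * μ Q₀.toSet := by
  induction n with
  | zero => simp [generation]
  | succ n ih =>
    calc ∑' Q : generation next Q₀ (n + 1), μ Q.1.toSet
        ≤ ∑' Q : generation next Q₀ n, ∑' P : next Q.1, μ P.1.toSet :=
          ENNReal.tsum_biUnion_le_tsum (fun Q : DyadicCube d => μ Q.toSet) _ _
      _ ≤ ∑' Q : generation next Q₀ n, δ * μ Q.1.toSet := ENNReal.tsum_le_tsum fun Q => hμ Q
      _ = δ * ∑' Q : generation next Q₀ n, μ Q.1.toSet := ENNReal.tsum_mul_left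
      _ ≤ δ * ((δ : ℝ≥0∞) ^ n * μ Q₀.toSet) := by gcongr
      _ = (δ : ℝ≥0∞) ^ (n + 1) * μ Q₀.toSet := by ring

lemma ae_exists_notMem_generation [IsLocallyFiniteMeasure μ] {δ : ℝ≥0} (hδ : δ < 1)
    (hμ : ∀ Q, ∑' P : next Q, μ P.1.toSet ≤ δ * μ Q.toSet) :
    ∀ᵐ x ∂μ, ∃ n, ∀ Q ∈ generation next Q₀ n, x ∉ Q.toSet := by
  rw [ae_iff]
  refine le_antisymm (ge_of_tendsto' (x := Filter.atTop)
    (f := fun n : ℕ => (δ : ℝ≥0∞) ^ n * μ Q₀.toSet) ?_ fun n => ?_) zero_le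
  · have h := ENNReal.Tendsto.mul_const (b := μ Q₀.toSet)
      (ENNReal.tendsto_pow_atTop_nhds_zero_of_lt_one (r := δ) (by exact_mod_cast hδ))
      (.inr (Q₀.measure_toSet_lt_top μ).ne)
    rwa [zero_mul] at h
  · refine (measure_mono fun x hx => ?_).trans
      ((measure_iUnion_le fun Q : generation next Q₀ n => Q.1.toSet).trans
        (tsum_generation_le hμ n))
    simp only [Set.mem_ofPred_eq] at hx
    push Not at hx
    obtain ⟨Q, hQ, hxQ⟩ := hx n
    exact Set.mem_iUnion.2 ⟨⟨Q, hQ⟩, hxQ⟩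

/-- A family of functions `a Q` that satisfies a one-step recursion along the stopping cubes is
dominated by the sum over all cubes of the stopping tree. -/
lemma le_tsum_generation (hsub : ∀ Q, ∀ P ∈ next Q, P.toSet ⊂ Q.toSet) {x : Fin d → ℝ}
    {a b : DyadicCube d → ℝ≥0∞}
    (h0 : ∀ Q, x ∈ Q.toSet → (∀ P ∈ next Q, x ∉ P.toSet) → a Q ≤ b Q)
    (h1 : ∀ Q, ∀ P ∈ next Q, x ∈ P.toSet → a Q ≤ b Q + a P)
    {n : ℕ} (hn : ∀ Q ∈ generation next Q₀ n, x ∉ Q.toSet) (hx : x ∈ Q₀.toSet) :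
    a Q₀ ≤ ∑' Q : {Q | Q ∈ ⋃ n, generation next Q₀ n ∧ x ∈ Q.toSet}, b Q := by
  -- Induction on the number j of generations left. Restricting the sum to R ⊆ Q makes the term of Q
  -- disjoint from the subtree below P.
  have key : ∀ (j m : ℕ), m + j = n → ∀ Q ∈ generation next Q₀ m, x ∈ Q.toSet →
      a Q ≤ ∑' R : {R | (R ∈ ⋃ n, generation next Q₀ n ∧ x ∈ R.toSet) ∧ R.toSet ⊆ Q.toSet},
        b R := by
    intro j
    induction j with
    | zero =>
      rintro m rfl Q hQ hxQ
      exact absurd hxQ (hn Q hQ)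
    | succ j ih =>
      intro m hm Q hQ hxQ
      have hQT : Q ∈ ⋃ n, generation next Q₀ n := Set.mem_iUnion.2 ⟨m, hQ⟩
      by_cases hP : ∃ P ∈ next Q, x ∈ P.toSet
      · obtain ⟨P, hP, hxP⟩ := hP
        have hPQ := hsub Q P hP
        have h2 := ih (m + 1) (by omega) P (Set.mem_iUnion₂.2 ⟨Q, hQ, hP⟩) hxP
        refine (h1 Q P hP hxP).trans ((add_le_add_right h2 _).trans ?_)
        have hdisj : Disjoint ({Q} : Set (DyadicCube d))
            {R | (R ∈ ⋃ n, generation next Q₀ n ∧ x ∈ R.toSet) ∧ R.toSet ⊆ P.toSet} :=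
          Set.disjoint_singleton_left.2 fun h => hPQ.2 h.2
        rw [← tsum_singleton Q b, ← ENNReal.summable.tsum_union_disjoint hdisj ENNReal.summable]
        refine ENNReal.tsum_mono_subtype b (Set.union_subset ?_ fun R hR =>
          ⟨hR.1, hR.2.trans hPQ.subset⟩)
        exact Set.singleton_subset_iff.2 ⟨⟨hQT, hxQ⟩, subset_rfl⟩
      · push Not at hP
        refine (h0 Q hxQ hP).trans ?_
        rw [← tsum_singleton Q b]
        exact ENNReal.tsum_mono_subtype b
          (Set.singleton_subset_iff.2 ⟨⟨hQT, hxQ⟩, subset_rfl⟩)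
  exact (key n 0 (zero_add n) Q₀ rfl hx).trans (ENNReal.tsum_mono_subtype b fun R hR => hR.1)

end Iteration

end DyadicCube

namespace DyadicCube

variable {d : ℕ}

/-! ### The stopping cubes and the one-step estimate. -/

section Stopping

variable (μ : Measure (Fin d → ℝ)) (f : (Fin d → ℝ) → ℝ) (𝓢 : Set (DyadicCube d)) (k M : ℕ)

/-- The cubes of `𝓢` that contain `P` and whose `k`-th ancestor is contained in `Q`. -/
def between (Q P : DyadicCube d) : Set (DyadicCube d) :=
  {S | (S ∈ 𝓢 ∧ (S.ancestor k).toSet ⊆ Q.toSet) ∧ P.toSet ⊆ S.toSet}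

/-- The cubes on which the average of `|f|` is large compared to that on `Q`. -/
def largeAverage (Q : DyadicCube d) : Set (DyadicCube d) :=
  {P | 4 * cubeAverage μ f Q < cubeAverage μ f P}

/-- The cubes with more than `M` cubes of `𝓢` between them and `Q`. -/
def largeCount (Q : DyadicCube d) : Set (DyadicCube d) :=
  {P | (M : ℕ∞) < (between 𝓢 k Q P).encard}

/-- The maximal cubes inside `Q` on which the average or the counting function is large. -/
def stoppingCubes (Q : DyadicCube d) : Set (DyadicCube d) :=
  childrenIn (largeAverage μ f Q ∪ largeCount 𝓢 k M Q) Q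

variable {μ f 𝓢 k M}

lemma measure_mul_cubeAverage [IsLocallyFiniteMeasure μ] (Q : DyadicCube d) :
    μ Q.toSet * cubeAverage μ f Q = μ.withDensity (fun x => ‖f x‖ₑ) Q.toSet := by
  rw [cubeAverage, measure_mul_setLAverage _ (Q.measure_toSet_lt_top μ).ne,
    withDensity_apply _ Q.measurableSet_toSet]

lemma four_mul_tsum_largeAverage_le [IsLocallyFiniteMeasure μ] {Q : DyadicCube d}
    {𝓐 : Set (DyadicCube d)} (h𝓐 : ∀ P ∈ 𝓐, ∀ R ∈ 𝓐, ∀ x ∈ P.toSet, x ∈ R.toSet → P = R)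
    (hQ : ∀ P ∈ 𝓐, P.toSet ⊆ Q.toSet) (hlarge : 𝓐 ⊆ largeAverage μ f Q) :
    4 * ∑' P : 𝓐, μ P.1.toSet ≤ μ Q.toSet := by
  rcases 𝓐.eq_empty_or_nonempty with rfl | ⟨P₀, hP₀⟩
  · simp
  have htop : cubeAverage μ f Q ≠ ∞ := by
    intro h
    have := hlarge hP₀
    simp [largeAverage, h] at this
  have h1 : (4 * ∑' P : 𝓐, μ P.1.toSet) * cubeAverage μ f Q
      ≤ μ Q.toSet * cubeAverage μ f Q := by
    rw [measure_mul_cubeAverage]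
    refine le_trans ?_ (tsum_measure_le (μ.withDensity fun x => ‖f x‖ₑ) h𝓐 hQ)
    rw [mul_right_comm, mul_comm, ← ENNReal.tsum_mul_right]
    refine ENNReal.tsum_le_tsum fun P => ?_
    rw [← measure_mul_cubeAverage]
    gcongr
    exact (hlarge P.2).le
  -- Cancelling the average needs it nonzero. If it vanishes, |f| has no mass on P although its
  -- average there is positive, so μ(P) = 0.
  rcases eq_or_ne (cubeAverage μ f Q) 0 with h0 | h0
  · have hz : ∀ P : 𝓐, μ P.1.toSet = 0 := by
      intro P
      have hle := measure_mono (μ := μ.withDensity fun x => ‖f x‖ₑ) (hQ P P.2)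
      rw [← measure_mul_cubeAverage, ← measure_mul_cubeAverage, h0, mul_zero,
        nonpos_iff_eq_zero, mul_eq_zero] at hle
      refine hle.resolve_right fun h => ?_
      have := hlarge P.2
      simp [largeAverage, h] at this
    simp [hz]
  · exact (ENNReal.mul_le_mul_iff_left h0 htop).1 h1

/-- Double counting: each P lies in at least M of the cubes S, and the disjoint P inside one S have
total measure at most μ(S). -/
lemma natCast_mul_tsum_largeCount_le {Q : DyadicCube d} {𝓐 : Set (DyadicCube d)}
    (h𝓐 : ∀ P ∈ 𝓐, ∀ R ∈ 𝓐, ∀ x ∈ P.toSet, x ∈ R.toSet → P = R)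
    (hlarge : 𝓐 ⊆ largeCount 𝓢 k M Q) :
    (M : ℝ≥0∞) * ∑' P : 𝓐, μ P.1.toSet
      ≤ ∑' S : {S | S ∈ 𝓢 ∧ (S.ancestor k).toSet ⊆ Q.toSet}, μ S.1.toSet := by
  set 𝓛 := {S | S ∈ 𝓢 ∧ (S.ancestor k).toSet ⊆ Q.toSet}
  calc (M : ℝ≥0∞) * ∑' P : 𝓐, μ P.1.toSet = ∑' P : 𝓐, (M : ℝ≥0∞) * μ P.1.toSet :=
        ENNReal.tsum_mul_left.symm
    _ ≤ ∑' P : 𝓐, ∑' S : 𝓛, μ.restrict S.1.toSet P.1.toSet := by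
        refine ENNReal.tsum_le_tsum fun P => ?_
        have hM : (M : ℝ≥0∞) ≤ ∑' _ : between 𝓢 k Q P, (1 : ℝ≥0∞) := by
          rw [ENNReal.tsum_set_one]
          exact_mod_cast (hlarge P.2).le
        calc (M : ℝ≥0∞) * μ P.1.toSet
            ≤ (∑' _ : between 𝓢 k Q P, (1 : ℝ≥0∞)) * μ P.1.toSet := by gcongr
          _ = ∑' S : between 𝓢 k Q P, μ.restrict S.1.toSet P.1.toSet := by
              rw [← ENNReal.tsum_mul_right]
              refine tsum_congr fun S => ?_
              rw [one_mul, Measure.restrict_apply P.1.measurableSet_toSet,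
                Set.inter_eq_left.2 S.2.2]
          _ ≤ _ := ENNReal.tsum_mono_subtype
              (fun S : DyadicCube d => μ.restrict S.toSet P.1.toSet) fun S hS => hS.1
    _ = ∑' S : 𝓛, ∑' P : 𝓐, μ.restrict S.1.toSet P.1.toSet := ENNReal.tsum_comm
    _ ≤ ∑' S : 𝓛, μ S.1.toSet := by
        refine ENNReal.tsum_le_tsum fun S => ?_
        refine (tsum_measure_le _ h𝓐 fun P _ => Set.subset_univ _).trans_eq ?_
        rw [Measure.restrict_apply_univ]

lemma tsum_stoppingCubes_le [NeZero d] [IsLocallyFiniteMeasure μ] {γ : ℝ≥0}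
    (h𝓢 : IsSparseWith μ γ 𝓢) (hM : 4 ≤ (1 - γ) * M) (Q : DyadicCube d) :
    ∑' P : stoppingCubes μ f 𝓢 k M Q, μ P.1.toSet ≤ (1 / 2 : ℝ≥0) * μ Q.toSet := by
  set 𝓐 := stoppingCubes μ f 𝓢 k M Q
  have hdis : ∀ P ∈ 𝓐, ∀ R ∈ 𝓐, ∀ x ∈ P.toSet, x ∈ R.toSet → P = R :=
    fun P hP R hR x => eq_of_mem_childrenIn hP hR
  have h1 : 4 * ∑' P : ↑(𝓐 ∩ largeAverage μ f Q), μ P.1.toSet ≤ μ Q.toSet :=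
    four_mul_tsum_largeAverage_le (fun P hP R hR => hdis P hP.1 R hR.1)
      (fun P hP => hP.1.2.1.subset) Set.inter_subset_right
  have h2 : 4 * ∑' P : ↑(𝓐 ∩ largeCount 𝓢 k M Q), μ P.1.toSet ≤ μ Q.toSet := by
    have h3 := natCast_mul_tsum_largeCount_le (μ := μ)
      (fun P hP R hR => hdis P (Set.inter_subset_left hP) R (Set.inter_subset_left hR))
      (Set.inter_subset_right (s := 𝓐) (t := largeCount 𝓢 k M Q))
    have h4 := tsum_measure_le_of_isSparseWith h𝓢
      (𝓛 := {S | S ∈ 𝓢 ∧ (S.ancestor k).toSet ⊆ Q.toSet}) (fun S hS => hS.1)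
      (fun S hS => (subset_ancestor k S).trans hS.2)
    have hM' : (4 : ℝ≥0∞) ≤ ((1 - γ : ℝ≥0) : ℝ≥0∞) * M := by exact_mod_cast hM
    calc _ ≤ ((1 - γ : ℝ≥0) : ℝ≥0∞) * M * ∑' P : ↑(𝓐 ∩ largeCount 𝓢 k M Q), μ P.1.toSet := by
          gcongr
      _ ≤ μ Q.toSet := by
          rw [mul_assoc]
          exact (mul_le_mul_right h3 _).trans h4
  have h3 : ∑' P : 𝓐, μ P.1.toSet ≤ ∑' P : ↑(𝓐 ∩ largeAverage μ f Q), μ P.1.toSet +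
      ∑' P : ↑(𝓐 ∩ largeCount 𝓢 k M Q), μ P.1.toSet := by
    refine le_trans ?_ (ENNReal.tsum_union_le (fun P : DyadicCube d => μ P.toSet) _ _)
    refine ENNReal.tsum_mono_subtype (fun P : DyadicCube d => μ P.toSet) fun P hP => ?_
    rw [← Set.inter_union_distrib_left]
    exact ⟨hP, hP.1⟩
  have h4 : 4 * ∑' P : 𝓐, μ P.1.toSet ≤ 4 * ((1 / 2 : ℝ≥0) * μ Q.toSet) := by
    calc 4 * ∑' P : 𝓐, μ P.1.toSet ≤ μ Q.toSet + μ Q.toSet := by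
          refine (mul_le_mul_right h3 _).trans ?_
          rw [mul_add]
          exact add_le_add h1 h2
      _ = 4 * ((1 / 2 : ℝ≥0) * μ Q.toSet) := by
          rw [← two_mul, ← mul_assoc]
          congr 1
          have : (2 : ℝ≥0) = 4 * (1 / 2) := by norm_num
          exact_mod_cast congrArg ((↑) : ℝ≥0 → ℝ≥0∞) this
  exact (ENNReal.mul_le_mul_iff_right (by norm_num) (by norm_num)).1 h4

variable {x : Fin d → ℝ}

/-- The cubes of `𝓢` that contain `x` and whose `k`-th ancestor is contained in `Q`. -/
def localCubes (𝓢 : Set (DyadicCube d)) (k : ℕ) (x : Fin d → ℝ) (Q : DyadicCube d) :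
    Set (DyadicCube d) :=
  {S | (S ∈ 𝓢 ∧ (S.ancestor k).toSet ⊆ Q.toSet) ∧ x ∈ S.toSet}

lemma encard_between_self_le [NeZero d] (Q : DyadicCube d) :
    (between 𝓢 k Q Q).encard ≤ 1 := by
  rw [Set.encard_le_one_iff]
  intro S R hS hR
  have key : ∀ S ∈ between 𝓢 k Q Q, S = Q := fun S hS =>
    toSet_injective (((subset_ancestor k S).trans hS.1.2).antisymm hS.2)
  rw [key S hS, key R hR]

lemma ssubset_of_mem_largeCount [NeZero d] (hM : 1 ≤ M) {P Q : DyadicCube d}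
    (hP : P ∈ largeCount 𝓢 k M Q) (hPQ : P.toSet ⊆ Q.toSet) : P.toSet ⊂ Q.toSet := by
  refine hPQ.ssubset_of_ne fun h => ?_
  rw [toSet_injective h] at hP
  have h1 := hP.trans_le (encard_between_self_le Q)
  have : M < 1 := by exact_mod_cast h1
  omega

lemma encard_localCubes_le [NeZero d] (hM : 1 ≤ M) {Q : DyadicCube d}
    (hx : ∀ P ∈ stoppingCubes μ f 𝓢 k M Q, x ∉ P.toSet) :
    (localCubes 𝓢 k x Q).encard ≤ M := by
  by_contra! hlt
  -- The smallest of M + 1 such cubes lies in all of them, so it has a large count and is covered by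
  -- a stopping cube containing x.
  obtain ⟨t, ht, htc⟩ := Set.exists_subset_encard_eq (Order.add_one_le_of_lt hlt)
  have hfin : t.Finite := Set.finite_of_encard_eq_coe (k := M + 1) (by exact_mod_cast htc)
  have hne : t.Nonempty := by
    rw [← Set.encard_pos, htc]
    exact_mod_cast Nat.succ_pos M
  obtain ⟨S, hS, hmin⟩ := Set.exists_min_image t scale hfin hne
  have hSl := ht hS
  have hcount : S ∈ largeCount 𝓢 k M Q := by
    have hsub : t ⊆ between 𝓢 k Q S := fun R hR =>
      ⟨(ht hR).1, subset_of_mem hSl.2 (ht hR).2 (hmin R hR)⟩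
    refine lt_of_lt_of_le ?_ (Set.encard_le_encard hsub)
    rw [htc]
    exact_mod_cast Nat.lt_succ_self M
  obtain ⟨P, hP, hSP⟩ := exists_childrenIn
    (𝓕 := largeAverage μ f Q ∪ largeCount 𝓢 k M Q) (Or.inr hcount)
    (ssubset_of_mem_largeCount hM hcount ((subset_ancestor k S).trans hSl.1.2))
  exact hx P hP (hSP hSl.2)

lemma encard_localCubes_diff_le [NeZero d] (hM : 1 ≤ M) {P Q : DyadicCube d}
    (hP : P ∈ stoppingCubes μ f 𝓢 k M Q) (hxP : x ∈ P.toSet) :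
    (localCubes 𝓢 k x Q \ localCubes 𝓢 k x P).encard ≤ M + k := by
  set E := localCubes 𝓢 k x Q \ localCubes 𝓢 k x P with hE
  have hsub : E ⊆ between 𝓢 k Q P.parent ∪ {S ∈ E | S.scale ≤ P.scale} := by
    intro S hS
    rcases le_or_gt S.scale P.scale with h | h
    · exact Or.inr ⟨hS, h⟩
    · exact Or.inl ⟨hS.1.1, subset_of_mem (mem_parent hxP) hS.1.2 h⟩
  refine (Set.encard_le_encard hsub).trans ((Set.encard_union_le _ _).trans (add_le_add ?_ ?_))
  -- A large count for the parent would contradict the maximality of P.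
  · by_contra! hlt
    have hlt' : P.parent ∈ largeCount 𝓢 k M Q := hlt
    have hPQ : P.parent.toSet ⊆ Q.toSet :=
      subset_of_mem (mem_parent hxP) (hP.2.1.subset hxP) (scale_lt_of_ssubset hP.2.1)
    have heq := hP.2.2 P.parent (Or.inr hlt') (ssubset_of_mem_largeCount hM hlt' hPQ)
      fun y hy => mem_parent hy
    have := congrArg scale heq
    simp [parent] at this
  -- Cubes through x are determined by their scale; below this window of k scales, S^(k) ⊆ P.
  · have hmaps : Set.MapsTo scale {S ∈ E | S.scale ≤ P.scale}
        (Set.Ioc (P.scale - k) P.scale) := by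
      rintro S ⟨hS, hle⟩
      refine ⟨?_, hle⟩
      by_contra! h
      refine hS.2 ⟨⟨hS.1.1.1, subset_of_mem (mem_ancestor hS.1.2 k) hxP ?_⟩, hS.1.2⟩
      rw [scale_ancestor]
      omega
    have hinj : Set.InjOn scale {S ∈ E | S.scale ≤ P.scale} :=
      fun S hS R hR h => eq_of_mem hS.1.1.2 hR.1.1.2 h
    refine (Set.encard_le_encard_of_injOn hmaps hinj).trans ?_
    rw [← Finset.coe_Ioc, Set.encard_coe_eq_coe_finsetCard, Int.card_Ioc]
    simp

lemma cubeAverage_le_of_forall_not_subset [NeZero d] {Q S : DyadicCube d}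
    (hSQ : S.toSet ⊆ Q.toSet)
    (h : ∀ P ∈ stoppingCubes μ f 𝓢 k M Q, ¬ S.toSet ⊆ P.toSet) :
    cubeAverage μ f S ≤ 4 * cubeAverage μ f Q := by
  rcases eq_or_ne S.toSet Q.toSet with heq | hne
  · rw [toSet_injective heq]
    exact le_mul_of_one_le_left' (by norm_num)
  · by_contra! hlt
    obtain ⟨P, hP, hSP⟩ := exists_childrenIn
      (𝓕 := largeAverage μ f Q ∪ largeCount 𝓢 k M Q) (Or.inl hlt)
      (hSQ.ssubset_of_ne hne)
    exact h P hP hSP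

lemma tsum_cubeAverage_le {𝓔 : Set (DyadicCube d)} {Q : DyadicCube d} {n : ℕ}
    (hn : 𝓔.encard ≤ n)
    (h : ∀ S ∈ 𝓔, cubeAverage μ f (S.ancestor k) ≤ 4 * cubeAverage μ f Q) :
    ∑' S : 𝓔, cubeAverage μ f (S.1.ancestor k) ≤ 4 * n * cubeAverage μ f Q := by
  calc ∑' S : 𝓔, cubeAverage μ f (S.1.ancestor k)
      ≤ ∑' S : 𝓔, 1 * (4 * cubeAverage μ f Q) :=
        ENNReal.tsum_le_tsum fun S => (h S S.2).trans_eq (one_mul _).symm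
    _ = (𝓔.encard : ℝ≥0∞) * (4 * cubeAverage μ f Q) := by
        rw [ENNReal.tsum_mul_right, ENNReal.tsum_set_one]
    _ ≤ (n : ℝ≥0∞) * (4 * cubeAverage μ f Q) := by
        gcongr
        exact_mod_cast ENat.toENNReal_mono hn
    _ = 4 * n * cubeAverage μ f Q := by ring

lemma tsum_localCubes_le [NeZero d] (hM : 1 ≤ M) {Q : DyadicCube d}
    (hx : ∀ P ∈ stoppingCubes μ f 𝓢 k M Q, x ∉ P.toSet) :
    ∑' S : localCubes 𝓢 k x Q, cubeAverage μ f (S.1.ancestor k)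
      ≤ 4 * (M + k : ℕ) * cubeAverage μ f Q := by
  refine tsum_cubeAverage_le ((encard_localCubes_le hM hx).trans
    (by exact_mod_cast Nat.le_add_right M k)) fun S hS => ?_
  exact cubeAverage_le_of_forall_not_subset hS.1.2
    fun P hP hSP => hx P hP (hSP (mem_ancestor hS.2 k))

lemma tsum_localCubes_le_add [NeZero d] (hM : 1 ≤ M) {P Q : DyadicCube d}
    (hP : P ∈ stoppingCubes μ f 𝓢 k M Q) (hxP : x ∈ P.toSet) :
    ∑' S : localCubes 𝓢 k x Q, cubeAverage μ f (S.1.ancestor k)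
      ≤ 4 * (M + k : ℕ) * cubeAverage μ f Q +
        ∑' S : localCubes 𝓢 k x P, cubeAverage μ f (S.1.ancestor k) := by
  calc _ ≤ ∑' S : ↑(localCubes 𝓢 k x Q \ localCubes 𝓢 k x P ∪ localCubes 𝓢 k x P),
          cubeAverage μ f (S.1.ancestor k) := by
        refine ENNReal.tsum_mono_subtype
          (fun S : DyadicCube d => cubeAverage μ f (S.ancestor k)) fun S hS => ?_
        by_cases h : S ∈ localCubes 𝓢 k x P
        · exact Or.inr h
        · exact Or.inl ⟨hS, h⟩
    _ ≤ _ := ENNReal.tsum_union_le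
        (fun S : DyadicCube d => cubeAverage μ f (S.ancestor k)) _ _
    _ ≤ _ := by
        gcongr
        refine tsum_cubeAverage_le
          (by exact_mod_cast encard_localCubes_diff_le hM hP hxP) fun S hS => ?_
        refine cubeAverage_le_of_forall_not_subset (𝓢 := 𝓢) (k := k) (M := M) hS.1.1.2 fun R hR hSR => hS.2 ?_
        -- A stopping cube R ⊇ S^(k) contains x, so it is P, and S would be counted for P.
        obtain rfl := eq_of_mem_childrenIn hP hR hxP (hSR (mem_ancestor hS.1.2 k))
        exact ⟨⟨hS.1.1.1, hSR⟩, hS.1.2⟩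

end Stopping

lemma subset_ancestor_of_subset [NeZero d] {Q R : DyadicCube d} (h : Q.toSet ⊆ R.toSet) (k : ℕ) :
    (Q.ancestor k).toSet ⊆ (R.ancestor k).toSet := by
  obtain ⟨x, hx⟩ := Q.nonempty_toSet
  refine subset_of_mem (mem_ancestor hx k) (mem_ancestor (h hx) k) ?_
  rw [scale_ancestor, scale_ancestor]
  gcongr
  exact scale_le_of_subset h

end DyadicCube

/-! ### Assembly of the domination. -/

open DyadicCube

lemma positiveDyadicOperator_eq_tsum {d : ℕ} (μ : Measure (Fin d → ℝ)) (𝓢 : Set (DyadicCube d))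
    (k : ℕ) (f : (Fin d → ℝ) → ℝ) (x : Fin d → ℝ) :
    positiveDyadicOperator μ 𝓢 k f x =
      ∑' S : {S | S ∈ 𝓢 ∧ x ∈ S.toSet}, cubeAverage μ f (S.1.ancestor k) := by
  rw [positiveDyadicOperator, tsum_subtype 𝓢 fun S : DyadicCube d =>
      S.toSet.indicator (fun _ => cubeAverage μ f (S.ancestor k)) x,
    tsum_subtype {S | S ∈ 𝓢 ∧ x ∈ S.toSet} fun S : DyadicCube d => cubeAverage μ f (S.ancestor k)]
  refine tsum_congr fun S => ?_
  by_cases hS : S ∈ 𝓢 <;> by_cases hx : x ∈ S.toSet <;> simp [hS, hx]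

theorem mainTheorem1 (γ : ℝ≥0) (hγ0 : 0 < γ) (hγ1 : γ < 1) :
    ∃ C : ℝ≥0, ∀ (d : ℕ), 1 ≤ d →
      ∀ (μ : Measure (Fin d → ℝ)) [IsLocallyFiniteMeasure μ]
        (𝓢 : Set (DyadicCube d)), IsSparseWith μ γ 𝓢 →
        (∃ S₀ ∈ 𝓢, ∀ S ∈ 𝓢, S.toSet ⊆ S₀.toSet) →
        ∀ (k : ℕ) (f : (Fin d → ℝ) → ℝ), AEMeasurable f μ →
          ∃ 𝓣 : Set (DyadicCube d), IsSparseWith μ (1 / 2) 𝓣 ∧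
            ∀ᵐ x ∂μ, positiveDyadicOperator μ 𝓢 k f x ≤
              C * (k + 1) * positiveDyadicOperator μ 𝓣 0 f x := by
  obtain ⟨M, hM⟩ := exists_nat_ge (4 / (1 - γ))
  rw [div_le_iff₀ (tsub_pos_of_lt hγ1), mul_comm] at hM
  have hM1 : 1 ≤ M := by
    by_contra! h
    rw [show M = 0 by omega] at hM
    simp at hM
  refine ⟨4 * (M + 1 : ℕ), fun d hd μ _ 𝓢 h𝓢 ⟨S₀, hS₀, hmax⟩ k f _ => ?_⟩
  have : NeZero d := ⟨by omega⟩
  set next := stoppingCubes μ f 𝓢 k M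
  set Q₀ := S₀.ancestor k
  have hsub : ∀ Q, ∀ P ∈ next Q, P.toSet ⊂ Q.toSet := fun Q P hP => hP.2.1
  have hdis : ∀ Q, ∀ P ∈ next Q, ∀ R ∈ next Q, ∀ x ∈ P.toSet, x ∈ R.toSet → P = R :=
    fun Q P hP R hR x => eq_of_mem_childrenIn hP hR
  have hμ : ∀ Q, ∑' P : next Q, μ P.1.toSet ≤ (1 / 2 : ℝ≥0) * μ Q.toSet :=
    tsum_stoppingCubes_le h𝓢 hM
  refine ⟨⋃ n, generation next Q₀ n, isSparseWith_iUnion_generation hsub hdis hμ, ?_⟩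
  filter_upwards [ae_exists_notMem_generation (Q₀ := Q₀) (by norm_num) hμ] with x ⟨n, hn⟩
  have hlocal : {S | S ∈ 𝓢 ∧ x ∈ S.toSet} ⊆ localCubes 𝓢 k x Q₀ := fun S hS =>
    ⟨⟨hS.1, subset_ancestor_of_subset (hmax S hS.1) k⟩, hS.2⟩
  rw [positiveDyadicOperator_eq_tsum, positiveDyadicOperator_eq_tsum]
  refine (ENNReal.tsum_mono_subtype
    (fun S : DyadicCube d => cubeAverage μ f (S.ancestor k)) hlocal).trans ?_
  by_cases hx : x ∈ Q₀.toSet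
  · refine (le_tsum_generation (a := fun Q => ∑' S : localCubes 𝓢 k x Q,
        cubeAverage μ f (S.1.ancestor k))
      (b := fun Q => 4 * (M + k : ℕ) * cubeAverage μ f Q) hsub
      (fun Q _ hQ => tsum_localCubes_le hM1 hQ)
      (fun Q P hP hxP => tsum_localCubes_le_add hM1 hP hxP) hn hx).trans ?_
    rw [ENNReal.tsum_mul_left]
    refine mul_le_mul' ?_ le_rfl
    -- The only place where the complexity enters the constant: M + k ≤ (M + 1)(k + 1).
    have : 4 * (M + k) ≤ 4 * (M + 1) * (k + 1) := by nlinarith [Nat.zero_le (M * k)]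
    exact_mod_cast this
  · have hempty : localCubes 𝓢 k x Q₀ = ∅ :=
      Set.eq_empty_of_forall_notMem fun S hS => hx (hS.1.2 (mem_ancestor hS.2 k))
    rw [hempty]
    simp
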